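/- **Setting.** Let $\mathcal X$ be a finite set, $T>0$, and let $X$ be a continuous-time Markov chain on $[0,T]$ with state space $\mathcal X$, right-continuous piecewise-constant paths, and transition function $Q_{t,r}(y|x)$, $0\le t\le r\le T$, such that $r\mapsto Q_{t,r}(y|x)$ is continuous on $[t,T]$ (no fixed times of discontinuity). Assume that the transition rates $$G_t(y|x)=\lim_{\tau\downarrow0}\tfrac1\tau\big[Q_{t,t+\tau}(y|x)-\delta_x(y)\big],\qquad 0\le t<T,$$ exist and are uniformly bounded. Let $\Xi$ be the set of right-continuous piecewise-constant paths $[0,T]\to\mathcal X$ with arbitrary initial state, $\mathcal F_t$ the $\sigma$-algebra generated by the coordinates on $[0,t]$, and $\mathcal Z_t$ the space of bounded $\mathcal F_t$-measurable functions on $\Xi$. For $\xi\in\Xi$ let $P_t^{\xi}$ be the law of the path equal to $\xi$ on $[0,t]$ and continued after $t$ by the chain started at time $t$ from $\xi_t$. **Risk measure.** Let $\varrho=\{\varrho_{t,T}\}_{t\in[0,T]}$, $\varrho_{t,T}:\mathcal Z_T\to\mathcal Z_t$, be a dynamic risk measure which is - coherent: each $\varrho_{t,T}$ is monotone, convex,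 positively homogeneous, and satisfies $\varrho_{t,T}(Y+Z)=Y+\varrho_{t,T}(Z)$ for $Y\in\mathcal Z_t$, $Z\in\mathcal Z_T$; - strongly stochastically conditionally time-consistent: for $t\in[0,T]$, $r_1,r_2\in[t,T]$, $\xi\in\Xi$, $Z,W\in\mathcal Z_T$, if $P_t^\xi\{\varrho_{r_1,T}(Z)>\eta\}\le P_t^\xi\{\varrho_{r_2,T}(W)>\eta\}$ for all $\eta\in\mathbb R$, then $\varrho_{t,T}(Z)(\xi)\le\varrho_{t,T}(W)(\xi)$; - Markovian: for all $c\in L_\infty([t,T]\times\mathcal X)$ and $f:\mathcal X\to\mathbb R$, the value $\varrho_{t,T}\big(\int_t^Tc_\tau(X_\tau)\,d\tau+f(X_T)\big)(\xi)$ depends on $\xi$ only through $\xi_t$; - Lipschitz: there are $p\in[1,\infty)$ and $L\ge 0$ with $|\varrho_{t,T}(Z)(\xi)-\varrho_{t,T}(W)(\xi)|\le L\,\|Z-W\|_{L_p(P_t^\xi)}$ for all $0\le t\le r\le T$, $\xi\in\Xi$, $Z,W\in\mathcal Z_r$. **Transition risk mappings.** Let $\sigma_t(x,m,v)\in\mathbb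 R$ ($t\in[0,T]$, $x\in\mathcal X$, $m$ a probability vector on $\mathcal X$, $v:\mathcal X\to\mathbb R$) be coherent transition risk mappings of $\varrho$: $\sigma_t(x,m,\cdot)$ is a coherent measure of risk for all $t,x,m$, and $\sigma_t(\xi_t,Q_{t,r}(\cdot|\xi_t),w)=\varrho_{t,T}(w(X_r))(\xi)$ for all $0\le t\le r\le T$, $\xi\in\Xi$, $w:\mathcal X\to\mathbb R$. Put $$\mathcal A_t(x,m)=\Big\{\mu\text{ a probability vector}:\ \sum_y v(y)\mu(y)\le\sigma_t(x,m,v)\ \ \forall v\Big\},$$ $$\mathfrak M_t(K)=\{M\text{ a stochastic kernel}:\ M(x)\in\mathcal A_t(x,K(x))\ \ \forall x\}.$$ **Multigenerators.** Let $I$ be the identity kernel $x\mapsto\delta_x$, let signed kernels carry the norm $\|K\|=\max_x\sum_y|K(y|x)|$, and let $\mathcal T$ be the tangent cone at $I$ to the set of stochastic kernels. Assume that, for every $t\in[0,T)$, $\mathfrak M_t$ is semi-differentiable at $I$ in the direction $G_t$: there is a nonempty closed set $\mathfrak D_t$ of signed kernels such that, in the Pompeiu–Hausdorff distance, $$\tfrac1{\varepsilon_n}\big[\mathfrak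 M_t(I+\varepsilon_nK_n)-I\big]\to\mathfrak D_t$$ for all sequences $\varepsilon_n>0$, $\varepsilon_n\to0$, and $K_n\in\mathcal T$, $K_n\to G_t$. Assume that the risk multigenerators $\mathfrak G_t(x)=\{D(x):D\in\mathfrak D_t\}$ are, for each $x\in\mathcal X$, measurable and uniformly continuous (in the Pompeiu–Hausdorff distance) in $t\in[0,T)$, and that they are uniformly bounded over $t$ and $x$. Let $c:[0,T]\times\mathcal X\to\mathbb R$ be such that $t\mapsto c_t(x)$ is uniformly continuous on $[0,T]$ for each $x$, and let $f:\mathcal X\to\mathbb R$. **Approximation.** Let $$v_t(x)=\varrho_{t,T}\Big(\int_t^Tc_\tau(X_\tau)\,d\tau+f(X_T)\Big)(\xi)\qquad\text{for any }\xi\in\Xi\text{ with }\xi_t=x.$$ For $N\ge1$ put $\varepsilon_N=T/N$, $t_i=i\varepsilon_N$, $v^N_{t_N}=f$, and $$v^N_{t_i}(x)=\varepsilon_Nc_{t_i}(x)+\sigma_{t_i}\big(x,Q_{t_i,t_{i+1}}(\cdot|x),v^N_{t_{i+1}}\big),\qquad i=N-1,\dots,0,$$ and let $v^N_t(x)$,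 $t\in[0,T]$, be the piecewise linear interpolation in $t$. **Theorem.** For each $x$ the functions $t\mapsto v^N_t(x)$ ($N\ge1$) and $t\mapsto v_t(x)$ are continuous on $[0,T]$, and $$\max_{x\in\mathcal X}\ \sup_{0\le t\le T}|v^N_t(x)-v_t(x)|\to0\qquad\text{as }N\to\infty.$$ -/

import Mathlib

open Set Filter Topology MeasureTheory
open scoped ENNReal NNReal

noncomputable section

namespace RiskChain

/-! ### Path space -/

/-- Right-continuous piecewise-constant functions `[0,T] → X`. They are stored as functions on `ℝ`:
all jump times lie in the finite set `J ⊆ (0,T]`, so the function is constant on each of the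
half-open pieces `[j, j')` cut out by `J`; in particular it is constant on `(-∞,0]` and on `[T,∞)`,
and carries no information beyond its values on `[0,T]`. -/
def Path (X : Type*) (T : ℝ) : Type _ :=
  {ω : ℝ → X // ∃ J : Finset ℝ, (∀ j ∈ J, j ∈ Ioc 0 T) ∧
    ∀ s t : ℝ, s ≤ t → (∀ j ∈ J, j ∉ Ioc s t) → ω s = ω t}

instance (X : Type*) (T : ℝ) : CoeFun (Path X T) (fun _ => ℝ → X) := ⟨fun ω => ω.1⟩

/-- The path that stays at `x`. -/
def Path.const {X : Type*} (T : ℝ) (x : X) : Path X T :=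
  ⟨fun _ => x, ∅, by simp, fun _ _ _ _ => rfl⟩

/-- The σ-algebra `ℱ_t` generated by the coordinates `X_s`, `0 ≤ s ≤ t`. -/
@[reducible] def history (X : Type*) (T t : ℝ) : MeasurableSpace (Path X T) :=
  ⨆ s ∈ Icc 0 t, MeasurableSpace.comap (fun ω : Path X T => ω s) ⊤

instance (X : Type*) (T : ℝ) : MeasurableSpace (Path X T) := history X T T

/-- The space `𝒵_t` of bounded `ℱ_t`-measurable random variables. -/
def RV (X : Type*) (T t : ℝ) : Set (Path X T → ℝ) :=
  {Z | Measurable[history X T t] Z ∧ ∃ C : ℝ, ∀ ω, |Z ω| ≤ C}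

/-! ### The Markov chain -/

/-- A continuous-time Markov chain on `[0,T]` with finite state space `X`: its transition function
`Q t r x y = Q_{t,r}(y|x)`, without fixed times of discontinuity, and its path laws.
`law t ξ` is the law of the path that follows the history `ξ` on `[0,t]` and is continued after `t`
by the chain started at time `t` from `ξ t`. It is the image of the law `P_{t,T}^{ξ_t}` of the
chain on `[t,T]` under concatenation with `ξ_{[0,t]}`, and the law of a random variable `Z`
under `law t ξ` is the conditional distribution of `Z` given the history `ξ_{[0,t]}`. -/
structure MarkovChain (X : Type*) [Fintype X] [DecidableEq X] (T : ℝ) where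
  Q : ℝ → ℝ → X → X → ℝ
  nonneg : ∀ t r, 0 ≤ t → t ≤ r → r ≤ T → ∀ x y, 0 ≤ Q t r x y
  sum_eq_one : ∀ t r, 0 ≤ t → t ≤ r → r ≤ T → ∀ x, ∑ y, Q t r x y = 1
  refl : ∀ t, 0 ≤ t → t ≤ T → ∀ x y, Q t t x y = if x = y then 1 else 0
  chapman_kolmogorov : ∀ t s r, 0 ≤ t → t ≤ s → s ≤ r → r ≤ T → ∀ x y,
    Q t r x y = ∑ z, Q t s x z * Q s r z y
  continuous : ∀ t, 0 ≤ t → t ≤ T → ∀ x y, ContinuousOn (fun r => Q t r x y) (Icc t T)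
  law : ℝ → Path X T → Measure (Path X T)
  law_prob : ∀ t, 0 ≤ t → t ≤ T → ∀ ξ, IsProbabilityMeasure (law t ξ)
  law_history : ∀ t, 0 ≤ t → t ≤ T → ∀ ξ, ∀ᵐ ω ∂(law t ξ), ∀ s ∈ Icc 0 t, ω s = ξ s
  law_cylinder : ∀ t, 0 ≤ t → t ≤ T → ∀ ξ : Path X T,
    ∀ (n : ℕ) (s : ℕ → ℝ) (y : ℕ → X),
      s 0 = t → (∀ i < n, s i ≤ s (i + 1)) → s n ≤ T → y 0 = ξ t →
      law t ξ {ω | ∀ i ≤ n, ω (s i) = y i} =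
        ENNReal.ofReal (∏ i ∈ Finset.range n, Q (s i) (s (i + 1)) (y i) (y (i + 1)))

/-- `G t x y = G_t(y|x)` are the transition rates of the transition function `Q`:
the right derivatives exist at every time before the horizon, and are uniformly bounded. -/
def IsRate {X : Type*} [DecidableEq X] (T : ℝ) (Q : ℝ → ℝ → X → X → ℝ)
    (G : ℝ → X → X → ℝ) : Prop :=
  (∀ t ∈ Ico 0 T, ∀ x y,
    Tendsto (fun τ : ℝ => (1 / τ) * (Q t (t + τ) x y - if x = y then 1 else 0))
      (𝓝[>] 0) (𝓝 (G t x y))) ∧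
  ∃ C : ℝ, ∀ t ∈ Ico 0 T, ∀ x y, |G t x y| ≤ C

/-! ### Dynamic risk measures

A dynamic risk measure is a family `ϱ t = ϱ_{t,T}` of maps from `𝒵_T` to `𝒵_t`; `ϱ t Z ξ` is the
value at the history `ξ_{[0,t]}`. Values of `ϱ t` outside `𝒵_T`, or for `t ∉ [0,T]`, play no role. -/

section RiskMeasure

variable {X : Type*} {T : ℝ}

def IsDynamicRiskMeasure (ϱ : ℝ → (Path X T → ℝ) → Path X T → ℝ) : Prop :=
  ∀ t ∈ Icc 0 T, ∀ Z ∈ RV X T T, ϱ t Z ∈ RV X T t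

/-- Coherence: monotonicity, translation invariance, convexity, positive homogeneity. -/
structure IsCoherent (ϱ : ℝ → (Path X T → ℝ) → Path X T → ℝ) : Prop where
  mono : ∀ t ∈ Icc 0 T, ∀ Z ∈ RV X T T, ∀ W ∈ RV X T T, Z ≤ W → ϱ t Z ≤ ϱ t W
  translation : ∀ t ∈ Icc 0 T, ∀ Z ∈ RV X T T, ∀ Y ∈ RV X T t, ϱ t (Y + Z) = Y + ϱ t Z
  convex : ∀ t ∈ Icc 0 T, ∀ Z ∈ RV X T T, ∀ W ∈ RV X T T, ∀ a ∈ Icc (0 : ℝ) 1,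
    ϱ t (a • Z + (1 - a) • W) ≤ a • ϱ t Z + (1 - a) • ϱ t W
  pos_hom : ∀ t ∈ Icc 0 T, ∀ Z ∈ RV X T T, ∀ γ : ℝ, 0 ≤ γ → ϱ t (γ • Z) = γ • ϱ t Z

variable [Fintype X] [DecidableEq X]

/-- Strong stochastic conditional time consistency; the hypothesis inside is the usual stochastic
order between the conditional distributions of `ϱ_{r₁,T}(Z)` and `ϱ_{r₂,T}(W)` given `ξ_{[0,t]}`. -/
def IsStronglyConsistent (M : MarkovChain X T)
    (ϱ : ℝ → (Path X T → ℝ) → Path X T → ℝ) : Prop :=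
  ∀ t ∈ Icc 0 T, ∀ r₁ ∈ Icc t T, ∀ r₂ ∈ Icc t T, ∀ ξ : Path X T,
    ∀ Z ∈ RV X T T, ∀ W ∈ RV X T T,
      (∀ η : ℝ, M.law t ξ {ω | η < ϱ r₁ Z ω} ≤ M.law t ξ {ω | η < ϱ r₂ W ω}) →
        ϱ t Z ξ ≤ ϱ t W ξ

/-- The random cost `∫_t^T c_τ(X_τ) dτ + f(X_T)`. -/
def cost {X : Type*} {T : ℝ} (c : ℝ → X → ℝ) (f : X → ℝ) (t : ℝ) (ω : Path X T) : ℝ :=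
  (∫ τ in t..T, c τ (ω τ)) + f (ω T)

/-- The Markov property of a dynamic risk measure. The cost rates `c` range over
`L_∞([t,T] × X)`. -/
def IsMarkovian (ϱ : ℝ → (Path X T → ℝ) → Path X T → ℝ) : Prop :=
  ∀ t ∈ Icc 0 T, ∀ ξ ξ' : Path X T, ξ t = ξ' t →
    ∀ (c : ℝ → X → ℝ) (f : X → ℝ),
      (∀ x, MemLp (fun τ => c τ x) ⊤ (volume.restrict (Icc t T))) →
        ϱ t (cost c f t) ξ = ϱ t (cost c f t) ξ'

/-- The functionals `ς_{t,r}^{ξ}` are Lipschitz continuous in the norm of `L_p(P_{t,r}^{ξ_t})` for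
some `p ∈ [1,∞)`. For `Z ∈ 𝒵_r` one has `ϱ_{r,T}(Z) = Z`, so `ς_{t,r}^{ξ}` maps the random variable
`Z` (with the history `ξ_{[0,t]}` fixed) to `ϱ_{t,T}(Z)(ξ_{[0,t]})`. -/
def IsLpLipschitz (M : MarkovChain X T)
    (ϱ : ℝ → (Path X T → ℝ) → Path X T → ℝ) : Prop :=
  ∃ p : ℝ≥0∞, 1 ≤ p ∧ p ≠ ⊤ ∧ ∃ L : ℝ≥0,
    ∀ t ∈ Icc 0 T, ∀ r ∈ Icc t T, ∀ ξ : Path X T, ∀ Z ∈ RV X T r, ∀ W ∈ RV X T r,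
      ENNReal.ofReal |ϱ t Z ξ - ϱ t W ξ| ≤ L * eLpNorm (Z - W) p (M.law t ξ)

/-- The risk value function
`v_t(x) = ϱ_{t,T}(∫_t^T c_τ(X_τ) dτ + f(X_T))(ξ_{[0,t]})`, evaluated at the history that stays at `x`
(for a Markovian `ϱ`, every history with `ξ_t = x` gives the same value). -/
def value {X : Type*} {T : ℝ} (ϱ : ℝ → (Path X T → ℝ) → Path X T → ℝ)
    (c : ℝ → X → ℝ) (f : X → ℝ) (t : ℝ) (x : X) : ℝ :=
  ϱ t (cost c f t) (Path.const T x)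

end RiskMeasure

/-! ### Transition risk mappings -/

/-- A coherent measure of risk on functions `X → ℝ`. -/
structure IsCoherentFn {X : Type*} (s : (X → ℝ) → ℝ) : Prop where
  mono : ∀ v w, v ≤ w → s v ≤ s w
  translation : ∀ (a : ℝ) v, s (fun x => a + v x) = a + s v
  convex : ∀ v w, ∀ a ∈ Icc (0 : ℝ) 1, s (a • v + (1 - a) • w) ≤ a * s v + (1 - a) * s w
  pos_hom : ∀ v, ∀ γ : ℝ, 0 ≤ γ → s (γ • v) = γ * s v

/-- `σ t x m v` is a coherent transition risk mapping of `ϱ`: at the transition probabilities of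
the chain it gives the conditional risk of functions of the state,
`σ_t(ξ_t, Q_{t,r}(·|ξ_t), w) = ϱ_{t,T}(w(X_r))(ξ_{[0,t]})`, and it is a coherent measure of risk in
`w` for all probability vectors `m`. Taking `r = t` shows that it is state-consistent. -/
structure IsTransitionRiskMapping {X : Type*} [Fintype X] [DecidableEq X] {T : ℝ}
    (M : MarkovChain X T) (ϱ : ℝ → (Path X T → ℝ) → Path X T → ℝ)
    (σ : ℝ → X → (X → ℝ) → (X → ℝ) → ℝ) : Prop where
  represents : ∀ t ∈ Icc 0 T, ∀ r ∈ Icc t T, ∀ (ξ : Path X T) (w : X → ℝ),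
    σ t (ξ t) (M.Q t r (ξ t)) w = ϱ t (fun ω => w (ω r)) ξ
  coherent : ∀ t ∈ Icc 0 T, ∀ x, ∀ m ∈ stdSimplex ℝ X, IsCoherentFn (σ t x m)

/-! ### Risk multikernels and multigenerators -/

/-- Signed measures on the finite set `X`, with the total variation norm `∑ |μ(y)|`. -/
abbrev SMeas (X : Type*) := PiLp 1 (fun _ : X => ℝ)

/-- Signed kernels, `K x y = K(y|x)`; the norm is
`max_x ∑_y |K(y|x)| = sup {∑_y φ(y) K(y|x) : -1 ≤ φ ≤ 1, x ∈ X}`. -/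
abbrev SKernel (X : Type*) := X → SMeas X

section Multikernel

variable {X : Type*} [Fintype X] [DecidableEq X]

/-- The set of stochastic kernels. -/
def stochKernels (X : Type*) [Fintype X] : Set (SKernel X) :=
  {K | ∀ x, (fun y => K x y) ∈ stdSimplex ℝ X}

/-- The kernel `x ↦ δ_x`. -/
def idKernel (X : Type*) [DecidableEq X] : SKernel X :=
  fun x => WithLp.toLp 1 (Pi.single x 1)

/-- The tangent cone to the set of stochastic kernels at the identity kernel. -/
def tangentCone (X : Type*) [Fintype X] [DecidableEq X] : Set (SKernel X) :=
  {K | Tendsto (fun τ : ℝ =>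
      Metric.infEDist K ((fun M => τ⁻¹ • (M - idKernel X)) '' stochKernels X))
    (𝓝[>] 0) (𝓝 0)}

/-- The set `𝒜(x,m)` of the dual representation `σ(x,m,v) = max_{μ ∈ 𝒜(x,m)} ∑ v(y) μ(y)`:
the subdifferential of `σ(x,m,·)` at `0`. -/
def dualSet (σ : X → (X → ℝ) → (X → ℝ) → ℝ) (x : X) (m : X → ℝ) : Set (SMeas X) :=
  {μ | (fun y => μ y) ∈ stdSimplex ℝ X ∧ ∀ v : X → ℝ, ∑ y, v y * μ y ≤ σ x m v}

/-- The risk multikernel `𝔐(Q)` of the transition risk mapping `σ`. -/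
def multikernel (σ : X → (X → ℝ) → (X → ℝ) → ℝ) (K : SKernel X) : Set (SKernel X) :=
  {M | M ∈ stochKernels X ∧ ∀ x, M x ∈ dualSet σ x (fun y => K x y)}

/-- `D` is the semi-derivative of the multifunction `𝔐` at the identity kernel in the tangent
direction `K`: the limit of the difference quotients in the Pompeiu-Hausdorff distance. -/
def IsSemiDerivative (𝔐 : SKernel X → Set (SKernel X)) (K : SKernel X)
    (D : Set (SKernel X)) : Prop :=
  K ∈ tangentCone X ∧ D.Nonempty ∧ IsClosed D ∧
  ∀ (ε : ℕ → ℝ) (Kn : ℕ → SKernel X), (∀ n, 0 < ε n) → Tendsto ε atTop (𝓝 0) →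
    (∀ n, Kn n ∈ tangentCone X) → Tendsto Kn atTop (𝓝 K) →
    Tendsto (fun n => Metric.hausdorffEDist
        ((fun M => (ε n)⁻¹ • (M - idKernel X)) '' 𝔐 (idKernel X + ε n • Kn n)) D)
      atTop (𝓝 0)

/-- The rates as a signed kernel. -/
def rateKernel (g : X → X → ℝ) : SKernel X := fun x => WithLp.toLp 1 (g x)

/-- The component at `x` of a set of kernels. -/
def component {X : Type*} (D : Set (SKernel X)) (x : X) : Set (SMeas X) :=
  (fun K : SKernel X => K x) '' D

/-- `Γ t x` is the risk multigenerator of `σ` and `G`: the risk multikernels `𝔐_t` are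
semi-differentiable at the identity kernel in the directions `G_t`, and the components of their
semi-derivatives are the sets `Γ t x`. -/
def IsMultigenerator (T : ℝ) (σ : ℝ → X → (X → ℝ) → (X → ℝ) → ℝ) (G : ℝ → X → X → ℝ)
    (Γ : ℝ → X → Set (SMeas X)) : Prop :=
  ∀ t ∈ Ico 0 T, ∃ D : Set (SKernel X),
    IsSemiDerivative (multikernel (σ t)) (rateKernel (G t)) D ∧ ∀ x, Γ t x = component D x

end Multikernel

/-- Measurability of a set-valued function of `t ∈ [0,T)`. -/
def IsMeasurableMulti {E : Type*} [TopologicalSpace E] (T : ℝ) (Γ : ℝ → Set E) : Prop :=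
  ∀ U : Set E, IsOpen U → MeasurableSet {t | t ∈ Ico 0 T ∧ (Γ t ∩ U).Nonempty}

/-- Uniform continuity on `[0,T)` in the Pompeiu-Hausdorff distance. -/
def IsUnifContMulti {E : Type*} [PseudoEMetricSpace E] (T : ℝ) (Γ : ℝ → Set E) : Prop :=
  ∀ e : ℝ, 0 < e → ∃ δ : ℝ, 0 < δ ∧ ∀ s ∈ Ico 0 T, ∀ t ∈ Ico 0 T, |s - t| < δ →
    Metric.hausdorffEDist (Γ s) (Γ t) ≤ ENNReal.ofReal e

/-! ### Discrete-time approximation -/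

section Discrete

variable {X : Type*}

/-- The grid point `t_i = i T / N`. -/
def grid (T : ℝ) (N i : ℕ) : ℝ := i * (T / N)

/-- Backward recursion; the natural number counts the steps that are left until time `T`. -/
def stepsLeft (T : ℝ) (Q : ℝ → ℝ → X → X → ℝ) (σ : ℝ → X → (X → ℝ) → (X → ℝ) → ℝ)
    (c : ℝ → X → ℝ) (f : X → ℝ) (N : ℕ) : ℕ → X → ℝ
  | 0 => f
  | k + 1 => fun x =>
      (T / N) * c (grid T N (N - (k + 1))) x +
        σ (grid T N (N - (k + 1))) x
          (Q (grid T N (N - (k + 1))) (grid T N (N - (k + 1) + 1)) x)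
          (stepsLeft T Q σ c f N k)

/-- The discrete-time risk evaluation `v^N_{t_i}`, `i = 0, …, N`. -/
def discreteValue (T : ℝ) (Q : ℝ → ℝ → X → X → ℝ) (σ : ℝ → X → (X → ℝ) → (X → ℝ) → ℝ)
    (c : ℝ → X → ℝ) (f : X → ℝ) (N i : ℕ) : X → ℝ :=
  stepsLeft T Q σ c f N (N - i)

theorem discreteValue_last (T : ℝ) (Q : ℝ → ℝ → X → X → ℝ)
    (σ : ℝ → X → (X → ℝ) → (X → ℝ) → ℝ) (c : ℝ → X → ℝ) (f : X → ℝ) (N : ℕ) :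
    discreteValue T Q σ c f N N = f := by
  simp [discreteValue, stepsLeft]

theorem discreteValue_step (T : ℝ) (Q : ℝ → ℝ → X → X → ℝ)
    (σ : ℝ → X → (X → ℝ) → (X → ℝ) → ℝ) (c : ℝ → X → ℝ) (f : X → ℝ) (N i : ℕ)
    (hi : i < N) (x : X) :
    discreteValue T Q σ c f N i x =
      (T / N) * c (grid T N i) x +
        σ (grid T N i) x (Q (grid T N i) (grid T N (i + 1)) x)
          (discreteValue T Q σ c f N (i + 1)) := by
  obtain ⟨k, rfl⟩ : ∃ k, N = i + (k + 1) := ⟨N - i - 1, by omega⟩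
  have h1 : i + (k + 1) - i = k + 1 := by omega
  have h2 : i + (k + 1) - (i + 1) = k := by omega
  have h3 : i + (k + 1) - (k + 1) = i := by omega
  simp only [discreteValue, h1, h2, stepsLeft, h3]

/-- The piecewise linear interpolation of the values `V i` at the grid points `t_i`: on
`[t_i, t_{i+1})` it is `(t_{i+1} - t)/(t_{i+1} - t_i) V_i + (t - t_i)/(t_{i+1} - t_i) V_{i+1}`,
and at `T = t_N` it is `V N`. -/
def interpolate (T : ℝ) (N : ℕ) (V : ℕ → X → ℝ) (t : ℝ) (x : X) : ℝ :=
  let i := ⌊t / (T / N)⌋₊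
  (grid T N (i + 1) - t) / (grid T N (i + 1) - grid T N i) * V i x +
    (t - grid T N i) / (grid T N (i + 1) - grid T N i) * V (i + 1) x

/-- The approximation `v^N` on `[0,T] × X`. -/
def approxValue (T : ℝ) (Q : ℝ → ℝ → X → X → ℝ) (σ : ℝ → X → (X → ℝ) → (X → ℝ) → ℝ)
    (c : ℝ → X → ℝ) (f : X → ℝ) (N : ℕ) (t : ℝ) (x : X) : ℝ :=
  interpolate T N (discreteValue T Q σ c f N) t x

end Discrete

end RiskChain

end

namespace RiskChain

/-! ### Paths -/

section Paths

variable {X : Type*} {T : ℝ}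

/-! The argument is consistency plus stability, as for a one-step scheme for an ODE. Time
consistency and the Markov property give the dynamic programming equation `value_eq_risk`: on
`[t,s]`, of length `h`, the value is the risk of the running cost plus the value at `X_s`. The
scheme replaces the running cost by the constant `h * c t x`, which translation invariance takes out
of the risk, and `σ` represents what is left.

The replacement costs `o(h)`. Bounded rates make the probability of a jump at most `C * h`
(`MarkovChain.law_compl_stay_le`). Without a jump the two costs differ by at most `η * h`, by
uniform continuity of `c`; with a jump they differ by `O(h)`, and the `L_p` norm of this
contribution is `O(h) * (C * h) ^ (1/p)`. As `p` is finite this is again `o(h)`; see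
`IsLpLipschitz.exists_modulus` and `exists_abs_value_sub_step_le`. The same splitting, applied to
the value itself, gives its uniform continuity in time (`exists_abs_value_sub_le`).

Coherent `σ` is nonexpansive in the sup norm, so the `N` local errors `o(T/N)` merely add up
(`abs_discreteValue_sub_le`) and the total vanishes at the grid points. Uniform continuity of the
value controls the error of interpolation between them. -/

theorem Path.eventually_eq_right (ω : Path X T) (t : ℝ) : ∀ᶠ s in 𝓝[≥] t, ω s = ω t := by
  obtain ⟨J, -, hJ⟩ := ω.2
  have h : ∀ᶠ s in 𝓝 t, ∀ j ∈ J, j ∉ Ioc t s := by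
    rw [Filter.eventually_all_finset]
    intro j _
    rcases le_or_gt j t with hj | hj
    · exact .of_forall fun s hs => absurd hs.1 (not_lt.2 hj)
    · filter_upwards [Iio_mem_nhds hj] with s hs hs'
      exact absurd hs'.2 (not_le.2 hs)
  filter_upwards [h.filter_mono nhdsWithin_le_nhds, self_mem_nhdsWithin] with s hs hts
  exact (hJ t s hts hs).symm

theorem Path.eq_zero_of_nonpos (ω : Path X T) {s : ℝ} (hs : s ≤ 0) : ω s = ω 0 := by
  obtain ⟨J, hJ0, hJ⟩ := ω.2
  exact hJ s 0 hs fun j hj h => absurd (hJ0 j hj).1 (not_lt.2 h.2)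

theorem history_mono {s t : ℝ} (hst : s ≤ t) : history X T s ≤ history X T t :=
  biSup_mono fun _ hu => ⟨hu.1, hu.2.trans hst⟩

theorem measurableSet_coordinate_eq {t u : ℝ} (ht : 0 ≤ t) (hu : u ≤ t) (x : X) :
    MeasurableSet[history X T t] {ω : Path X T | ω u = x} := by
  have key : ∀ v ∈ Icc 0 t, MeasurableSet[history X T t] {ω : Path X T | ω v = x} := by
    intro v hv
    have hle : MeasurableSpace.comap (fun ω : Path X T => ω v) ⊤ ≤ history X T t :=
      le_iSup₂_of_le (f := fun s (_ : s ∈ Icc 0 t) =>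
        MeasurableSpace.comap (fun ω : Path X T => ω s) ⊤) v hv le_rfl
    exact hle _ ⟨{x}, trivial, rfl⟩
  rcases le_total 0 u with h0 | h0
  · exact key u ⟨h0, hu⟩
  · simpa only [Path.eq_zero_of_nonpos _ h0] using key 0 ⟨le_rfl, ht⟩

end Paths

/-! ### Measurability of right-continuous processes with discrete values -/

section RightContinuous

variable {Ω X : Type*} [MeasurableSpace Ω] {Y : Ω → ℝ → X}

/-- Round `τ` up to a grid of mesh `1/(n+1)`. Values are locally constant to the right, so the
rounded process eventually agrees with `Y`. The event is therefore a liminf of events that involve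
only countably many times. -/
theorem measurableSet_process_eq (x : X) (hY : ∀ u, MeasurableSet {o | Y o u = x})
    (hr : ∀ o τ, ∀ᶠ s in 𝓝[≥] τ, Y o s = Y o τ) :
    MeasurableSet {p : Ω × ℝ | Y p.1 p.2 = x} := by
  -- Floor plus one, not the floor: the approximating times must reach `τ` from the right.
  let ρ : ℕ → ℤ → ℝ := fun n k => ((k : ℝ) + 1) / ((n : ℝ) + 1)
  let κ : ℕ → ℝ → ℤ := fun n τ => ⌊((n : ℝ) + 1) * τ⌋
  have hlow : ∀ n τ, τ ≤ ρ n (κ n τ) := by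
    intro n τ
    rw [le_div_iff₀ (by positivity)]
    linarith [Int.lt_floor_add_one (((n : ℝ) + 1) * τ)]
  have hup : ∀ n τ, ρ n (κ n τ) ≤ τ + 1 / ((n : ℝ) + 1) := by
    intro n τ
    have hn : (0 : ℝ) < n + 1 := by positivity
    rw [div_le_iff₀ hn, add_mul, div_mul_cancel₀ _ hn.ne']
    linarith [Int.floor_le (((n : ℝ) + 1) * τ)]
  have hlim : ∀ τ, Tendsto (fun n => ρ n (κ n τ)) atTop (𝓝[≥] τ) := by
    intro τ
    refine tendsto_nhdsWithin_iff.2 ⟨?_, .of_forall fun n => hlow n τ⟩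
    refine tendsto_of_tendsto_of_tendsto_of_le_of_le tendsto_const_nhds ?_
      (fun n => hlow n τ) (fun n => hup n τ)
    simpa using tendsto_const_nhds.add (tendsto_one_div_add_atTop_nhds_zero_nat (𝕜 := ℝ))
  have hset : {p : Ω × ℝ | Y p.1 p.2 = x} =
      ⋃ N : ℕ, ⋂ n ≥ N, {p : Ω × ℝ | Y p.1 (ρ n (κ n p.2)) = x} := by
    ext ⟨o, τ⟩
    have hev := (hlim τ).eventually (hr o τ)
    simp only [mem_ofPred_eq, mem_iUnion, mem_iInter]
    constructor
    · rintro rfl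
      exact eventually_atTop.1 hev
    · rintro ⟨N, hN⟩
      obtain ⟨n, hn, hn'⟩ := (hev.and (eventually_ge_atTop N)).exists
      rw [← hn]
      exact hN n hn'
  rw [hset]
  refine .iUnion fun N => .iInter fun n => .iInter fun _ => ?_
  have h1 : MeasurableSet {q : Ω × ℤ | Y q.1 (ρ n q.2) = x} := by
    have : {q : Ω × ℤ | Y q.1 (ρ n q.2) = x} = ⋃ k : ℤ, {o | Y o (ρ n k) = x} ×ˢ {k} := by
      ext ⟨o, k⟩
      simp
    rw [this]
    exact .iUnion fun k => (hY _).prod (measurableSet_singleton k)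
  have h2 : Measurable fun p : Ω × ℝ => (p.1, κ n p.2) :=
    measurable_fst.prodMk (Int.measurable_floor.comp (measurable_snd.const_mul _))
  exact h2 h1

theorem measurable_runningCost [Fintype X] {c : ℝ → X → ℝ} (hc : ∀ x, Measurable fun τ => c τ x)
    (hY : ∀ u x, MeasurableSet {o | Y o u = x})
    (hr : ∀ o τ, ∀ᶠ s in 𝓝[≥] τ, Y o s = Y o τ) :
    Measurable fun p : Ω × ℝ => c p.2 (Y p.1 p.2) := by
  classical
  have : (fun p : Ω × ℝ => c p.2 (Y p.1 p.2)) =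
      fun p => ∑ x, {p : Ω × ℝ | Y p.1 p.2 = x}.indicator (fun p => c p.2 x) p := by
    ext p
    simp [Set.indicator_apply]
  rw [this]
  exact Finset.measurable_sum _ fun x _ => ((hc x).comp measurable_snd).indicator
    (measurableSet_process_eq x (fun u => hY u x) hr)

end RightContinuous

/-! ### Random variables -/

section RandomVariables

variable {X : Type*} {T : ℝ}

theorem RV_mono {s t : ℝ} (hst : s ≤ t) : RV X T s ⊆ RV X T t :=
  fun _ hZ => ⟨hZ.1.mono (history_mono hst) le_rfl, hZ.2⟩

theorem RV_const (t a : ℝ) : (fun _ => a) ∈ RV X T t :=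
  ⟨measurable_const, |a|, fun _ => le_rfl⟩

theorem RV_add {t : ℝ} {Z W : Path X T → ℝ} (hZ : Z ∈ RV X T t) (hW : W ∈ RV X T t) :
    Z + W ∈ RV X T t := by
  obtain ⟨hZm, A, hA⟩ := hZ
  obtain ⟨hWm, B, hB⟩ := hW
  exact ⟨hZm.add hWm, A + B, fun ω => (abs_add_le _ _).trans (add_le_add (hA ω) (hB ω))⟩

variable [Fintype X]

theorem exists_abs_le (w : X → ℝ) : ∃ C : ℝ, 0 ≤ C ∧ ∀ x, |w x| ≤ C :=
  ⟨∑ x, |w x|, Finset.sum_nonneg fun _ _ => abs_nonneg _, fun x =>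
    Finset.single_le_sum (f := fun x => |w x|) (fun _ _ => abs_nonneg _) (Finset.mem_univ x)⟩

theorem RV_coordinate {r s : ℝ} (hr : 0 ≤ r) (hs : s ≤ r) (w : X → ℝ) :
    (fun ω : Path X T => w (ω s)) ∈ RV X T r := by
  classical
  obtain ⟨C, -, hC⟩ := exists_abs_le w
  refine ⟨?_, C, fun ω => hC _⟩
  have : (fun ω : Path X T => w (ω s)) =
      fun ω => ∑ x, {ω : Path X T | ω s = x}.indicator (fun _ => w x) ω := by
    ext p
    simp [Set.indicator_apply]
  rw [this]
  exact @Finset.measurable_sum _ _ _ _ _ _ (history X T r) _ _ fun x _ =>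
    Measurable.indicator measurable_const (measurableSet_coordinate_eq hr hs x)

theorem Path.intervalIntegrable {c : ℝ → X → ℝ} (hc : ∀ x, Continuous fun τ => c τ x)
    {B : ℝ} (hB : ∀ τ x, |c τ x| ≤ B) (ω : Path X T) (t r : ℝ) :
    IntervalIntegrable (fun τ => c τ (ω τ)) volume t r := by
  -- A single path is a process on a one-point sample space.
  have hm : Measurable fun p : Unit × ℝ => c p.2 (ω p.2) := by
    refine measurable_runningCost (Y := fun (_ : Unit) τ => ω τ) (fun x => (hc x).measurable) ?_
      fun _ τ => ω.eventually_eq_right τ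
    intro u x
    by_cases h : ω u = x <;> simp [h]
  have hm' : Measurable fun τ => c τ (ω τ) := hm.comp (measurable_prodMk_left (x := ()))
  exact (intervalIntegrable_const (c := B)).mono_fun hm'.aestronglyMeasurable
    (.of_forall fun τ => (hB _ _).trans (le_abs_self B))

theorem RV_integral {c : ℝ → X → ℝ} (hc : ∀ x, Continuous fun τ => c τ x)
    {B : ℝ} (hB : ∀ τ x, |c τ x| ≤ B) {t r : ℝ} (hr : 0 ≤ r) (htr : t ≤ r) :
    (fun ω : Path X T => ∫ τ in t..r, c τ (ω τ)) ∈ RV X T r := by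
  refine ⟨?_, B * |r - t|, fun ω => ?_⟩
  swap
  · exact intervalIntegral.norm_integral_le_of_norm_le_const (f := fun τ => c τ (ω τ))
      fun τ _ => hB _ _
  -- Measurability is needed with respect to the past up to `r`, not `T`. Stopping the path at `r`
  -- leaves the integral unchanged, keeps right-continuity, and uses only coordinates up to `r`.
  let : MeasurableSpace (Path X T) := history X T r
  have hm : Measurable fun p : Path X T × ℝ => c p.2 (p.1 (min p.2 r)) := by
    refine measurable_runningCost (Y := fun (ω : Path X T) τ => ω (min τ r))
      (fun x => (hc x).measurable)
      (fun u x => measurableSet_coordinate_eq hr (min_le_right u r) x) fun ω τ => ?_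
    have : Tendsto (fun s => min s r) (𝓝[≥] τ) (𝓝[≥] (min τ r)) := by
      refine tendsto_nhdsWithin_iff.2 ⟨?_, ?_⟩
      · exact ((continuous_id.min continuous_const).tendsto τ).mono_left nhdsWithin_le_nhds
      · filter_upwards [self_mem_nhdsWithin] with s hs
        exact min_le_min_right r hs
    exact this.eventually (ω.eventually_eq_right (min τ r))
  have hI : (fun ω : Path X T => ∫ τ in t..r, c τ (ω τ)) =
      fun ω => ∫ τ in Ioc t r, c τ (ω (min τ r)) := by
    ext ω
    rw [intervalIntegral.integral_of_le htr]
    refine setIntegral_congr_fun measurableSet_Ioc fun τ hτ => ?_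
    simp [min_eq_left hτ.2]
  rw [hI]
  exact (hm.stronglyMeasurable.integral_prod_right (ν := volume.restrict (Ioc t r))).measurable

end RandomVariables

/-! ### The event of no jump -/

section Stay

variable {X : Type*} {T : ℝ}

/-- The event that the path stays at `x` on `[t,s]`. -/
def stay (T : ℝ) (t s : ℝ) (x : X) : Set (Path X T) := {ω | ∀ τ ∈ Icc t s, ω τ = x}

/-- The event that the path visits `x` at the points of the dyadic grid of level `n`. -/
def dyadicStay (T : ℝ) (t s : ℝ) (x : X) (n : ℕ) : Set (Path X T) :=
  {ω | ∀ i : ℕ, i ≤ 2 ^ n → ω (t + (i : ℝ) * ((s - t) / 2 ^ n)) = x}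

theorem dyadic_mem_Icc {t s : ℝ} (hts : t ≤ s) {n i : ℕ} (hi : i ≤ 2 ^ n) :
    t + (i : ℝ) * ((s - t) / 2 ^ n) ∈ Icc t s := by
  have hi' : (i : ℝ) ≤ 2 ^ n := by exact_mod_cast hi
  have h0 : 0 ≤ s - t := sub_nonneg.2 hts
  refine ⟨by have : 0 ≤ (i : ℝ) * ((s - t) / 2 ^ n) := by positivity
             linarith, ?_⟩
  have : (i : ℝ) * ((s - t) / 2 ^ n) ≤ 2 ^ n * ((s - t) / 2 ^ n) := by gcongr
  rw [mul_div_cancel₀ _ (by positivity)] at this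
  linarith

theorem dyadicStay_antitone (t s : ℝ) (x : X) : Antitone (dyadicStay T t s x) := by
  refine antitone_nat_of_succ_le fun n ω hω i hi => ?_
  have h := hω (2 * i) (by rw [pow_succ]; omega)
  have : t + ((2 * i : ℕ) : ℝ) * ((s - t) / 2 ^ (n + 1)) = t + (i : ℝ) * ((s - t) / 2 ^ n) := by
    push_cast
    rw [pow_succ]
    field_simp
  rwa [this] at h

/-- Right-continuity reduces the uncountably many constraints to dyadic times, which makes the event
measurable and a decreasing limit of cylinders. -/
theorem stay_eq_iInter {t s : ℝ} (hts : t ≤ s) (x : X) :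
    stay T t s x = ⋂ n, dyadicStay T t s x n := by
  refine Subset.antisymm (subset_iInter fun n ω hω i hi => hω _ (dyadic_mem_Icc hts hi)) ?_
  intro ω hω τ hτ
  rw [mem_iInter] at hω
  rcases hts.eq_or_lt with rfl | hlt
  · obtain rfl : τ = t := le_antisymm hτ.2 hτ.1
    simpa using hω 0 0 (by simp)
  have hh : 0 < s - t := sub_pos.2 hlt
  -- Rounding up approaches `τ` from the right. The right endpoint lies on every grid, so the index
  -- never exceeds `2 ^ n`.
  let k : ℕ → ℕ := fun n => ⌈(τ - t) / (s - t) * 2 ^ n⌉₊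
  have hfrac : 0 ≤ (τ - t) / (s - t) := div_nonneg (sub_nonneg.2 hτ.1) hh.le
  have hk : ∀ n, k n ≤ 2 ^ n := by
    intro n
    refine Nat.ceil_le.2 ?_
    push_cast
    refine mul_le_of_le_one_left (by positivity) ((div_le_one hh).2 ?_)
    linarith [hτ.2]
  have hcancel : ∀ n : ℕ, (τ - t) / (s - t) * 2 ^ n * ((s - t) / 2 ^ n) = τ - t := by
    intro n
    field_simp
  have hlow : ∀ n, τ ≤ t + (k n : ℝ) * ((s - t) / 2 ^ n) := by
    intro n
    have : (τ - t) / (s - t) * 2 ^ n * ((s - t) / 2 ^ n) ≤ (k n : ℝ) * ((s - t) / 2 ^ n) :=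
      mul_le_mul_of_nonneg_right (Nat.le_ceil _) (by positivity)
    rw [hcancel] at this
    linarith
  have hup : ∀ n, t + (k n : ℝ) * ((s - t) / 2 ^ n) ≤ τ + (s - t) / 2 ^ n := by
    intro n
    have : (k n : ℝ) * ((s - t) / 2 ^ n) ≤
        ((τ - t) / (s - t) * 2 ^ n + 1) * ((s - t) / 2 ^ n) :=
      mul_le_mul_of_nonneg_right (Nat.ceil_lt_add_one (by positivity)).le (by positivity)
    rw [add_mul, hcancel, one_mul] at this
    linarith
  have hlim : Tendsto (fun n => t + (k n : ℝ) * ((s - t) / 2 ^ n)) atTop (𝓝[≥] τ) := by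
    refine tendsto_nhdsWithin_iff.2 ⟨?_, .of_forall hlow⟩
    refine tendsto_of_tendsto_of_tendsto_of_le_of_le tendsto_const_nhds ?_ hlow hup
    have h2 : Tendsto (fun n : ℕ => (2 : ℝ) ^ n) atTop atTop :=
      tendsto_pow_atTop_atTop_of_one_lt one_lt_two
    simpa using tendsto_const_nhds.add (h2.const_div_atTop (s - t))
  obtain ⟨n, hn⟩ := (hlim.eventually (ω.eventually_eq_right τ)).exists
  rw [← hn]
  exact hω n (k n) (hk n)

theorem measurableSet_dyadicStay {t s : ℝ} (ht : 0 ≤ t) (hts : t ≤ s) (hs : s ≤ T) (x : X)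
    (n : ℕ) : MeasurableSet (dyadicStay T t s x n) := by
  have : dyadicStay T t s x n = ⋂ i ≤ 2 ^ n, {ω : Path X T |
      ω (t + ((i : ℕ) : ℝ) * ((s - t) / 2 ^ n)) = x} := by
    ext ω
    simp [dyadicStay]
  rw [this]
  exact .biInter (to_countable _) fun i hi => measurableSet_coordinate_eq
    (ht.trans (hts.trans hs)) ((dyadic_mem_Icc hts hi).2.trans hs) x

theorem measurableSet_stay {t s : ℝ} (ht : 0 ≤ t) (hts : t ≤ s) (hs : s ≤ T) (x : X) :
    MeasurableSet (stay T t s x) := by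
  rw [stay_eq_iInter hts]
  exact .iInter fun n => measurableSet_dyadicStay ht hts hs x n

end Stay

/-! ### Holding probabilities -/

section Holding

variable {X : Type*} [Fintype X] [DecidableEq X] {T : ℝ}

theorem MarkovChain.Q_le_one (M : MarkovChain X T) {t r : ℝ} (ht : 0 ≤ t) (htr : t ≤ r)
    (hr : r ≤ T) (x y : X) : M.Q t r x y ≤ 1 := by
  rw [← M.sum_eq_one t r ht htr hr x]
  exact Finset.single_le_sum (f := fun y => M.Q t r x y)
    (fun y _ => M.nonneg t r ht htr hr x y) (Finset.mem_univ y)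

/-- Kolmogorov's forward equation in right-derivative form: Chapman–Kolmogorov at the intermediate
time `r` turns the difference quotient into a finite combination of those defining the rates. -/
theorem MarkovChain.hasDerivWithinAt_Q (M : MarkovChain X T) {G : ℝ → X → X → ℝ}
    (hG : IsRate T M.Q G) {t r : ℝ} (ht : 0 ≤ t) (htr : t ≤ r) (hr : r < T) (x y : X) :
    HasDerivWithinAt (fun r => M.Q t r x y) (∑ z, M.Q t r x z * G r z y) (Ici r) r := by
  rw [← hasDerivWithinAt_Ioi_iff_Ici, hasDerivWithinAt_iff_tendsto_slope' self_notMem_Ioi]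
  have h0 : Tendsto (fun u => u - r) (𝓝[>] r) (𝓝[>] 0) := by
    refine tendsto_nhdsWithin_iff.2 ⟨?_, ?_⟩
    · have : Tendsto (fun u => u - r) (𝓝 r) (𝓝 (r - r)) := tendsto_id.sub_const r
      rw [sub_self] at this
      exact this.mono_left nhdsWithin_le_nhds
    · filter_upwards [self_mem_nhdsWithin] with u hu using sub_pos.2 (mem_Ioi.1 hu)
  have h1 := tendsto_finsetSum (f := fun z u => M.Q t r x z *
      ((1 / (u - r)) * (M.Q r (r + (u - r)) z y - if z = y then 1 else 0)))
    Finset.univ fun z _ => (((hG.1 r ⟨ht.trans htr, hr⟩ z y).comp h0).const_mul (M.Q t r x z))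
  refine h1.congr' ?_
  filter_upwards [self_mem_nhdsWithin, Ioo_mem_nhdsGT hr] with u hu hu'
  have hCK := M.chapman_kolmogorov t r u ht htr hu'.1.le hu'.2.le x y
  rw [slope_def_field, hCK, add_sub_cancel, div_eq_inv_mul]
  have : M.Q t r x y = ∑ z, M.Q t r x z * (if z = y then 1 else 0) := by simp
  conv_rhs => rw [this]
  rw [← Finset.sum_sub_distrib, Finset.sum_div]
  exact Finset.sum_congr rfl fun z _ => by ring

/-- The forward derivative averages rates against a probability vector, so it inherits their uniform
bound. The mean value inequality needs only continuity and right derivatives. -/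
theorem MarkovChain.exists_one_sub_Q_le (M : MarkovChain X T) {G : ℝ → X → X → ℝ}
    (hG : IsRate T M.Q G) : ∃ C : ℝ, 0 ≤ C ∧ ∀ t r, 0 ≤ t → t ≤ r → r ≤ T → ∀ x,
      1 - M.Q t r x x ≤ C * (r - t) := by
  obtain ⟨C, hC⟩ := hG.2
  refine ⟨|C|, abs_nonneg C, fun t r ht htr hr x => ?_⟩
  have h := norm_image_sub_le_of_norm_deriv_right_le_segment (f := fun r => M.Q t r x x)
    (a := t) (b := r) (C := |C|)
    ((M.continuous t ht (htr.trans hr) x x).mono (Icc_subset_Icc_right hr))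
    (fun u hu => M.hasDerivWithinAt_Q hG ht hu.1 (hu.2.trans_le hr) x x) ?_ r ⟨htr, le_rfl⟩
  · have h2 : M.Q t t x x = 1 := by simp [M.refl t ht (htr.trans hr)]
    simp only [h2, Real.norm_eq_abs] at h
    linarith [neg_abs_le (M.Q t r x x - 1)]
  · intro u hu
    have huT : u < T := hu.2.trans_le hr
    calc ‖∑ z, M.Q t u x z * G u z x‖ ≤ ∑ z, M.Q t u x z * |C| := by
          refine norm_sum_le_of_le _ fun z _ => ?_
          have hq := M.nonneg t u ht hu.1 huT.le x z
          rw [Real.norm_eq_abs, abs_mul, abs_of_nonneg hq]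
          exact mul_le_mul_of_nonneg_left
            ((hC u ⟨ht.trans hu.1, huT⟩ z x).trans (le_abs_self C)) hq
      _ = |C| := by rw [← Finset.sum_mul, M.sum_eq_one t u ht hu.1 huT.le, one_mul]

theorem one_sub_mul_le_prod {q : ℕ → ℝ} {a : ℝ} {n : ℕ} (h0 : ∀ i < n, 0 ≤ q i)
    (h1 : ∀ i < n, q i ≤ 1) (ha : ∀ i < n, 1 - q i ≤ a) :
    1 - n * a ≤ ∏ i ∈ Finset.range n, q i := by
  induction n with
  | zero => simp
  | succ n ih =>
    have hp : ∏ i ∈ Finset.range n, q i ≤ 1 :=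
      Finset.prod_le_one (fun i hi => h0 i (by grind)) fun i hi => h1 i (by grind)
    have := ih (fun i hi => h0 i (by lia)) (fun i hi => h1 i (by lia)) fun i hi => ha i (by lia)
    rw [Finset.prod_range_succ]
    push_cast
    nlinarith [ha n (by lia), h1 n (by lia)]

/-- Along the dyadic grid of level `n` each of the `2 ^ n` steps loses at most `C * (s - t) / 2 ^
n`, so the cylinder has probability at least `1 - C * (s - t)`. This bound does not depend on `n`
and passes to the limit. -/
theorem MarkovChain.law_compl_stay_le (M : MarkovChain X T) {C : ℝ}
    (hC : ∀ t r, 0 ≤ t → t ≤ r → r ≤ T → ∀ x, 1 - M.Q t r x x ≤ C * (r - t))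
    {t s : ℝ} (ht : 0 ≤ t) (hts : t ≤ s) (hs : s ≤ T) (ξ : Path X T) :
    M.law t ξ (stay T t s (ξ t))ᶜ ≤ ENNReal.ofReal (C * (s - t)) := by
  have htT := hts.trans hs
  have := M.law_prob t ht htT ξ
  have hn : ∀ n, ENNReal.ofReal (1 - C * (s - t)) ≤ M.law t ξ (dyadicStay T t s (ξ t) n) := by
    intro n
    let u : ℕ → ℝ := fun i => t + (i : ℝ) * ((s - t) / 2 ^ n)
    have hstep : ∀ i, u (i + 1) - u i = (s - t) / 2 ^ n := by
      intro i
      simp only [u]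
      push_cast
      ring
    have hpos : 0 ≤ (s - t) / 2 ^ n := div_nonneg (sub_nonneg.2 hts) (by positivity)
    have hu : ∀ i, u i ≤ u (i + 1) := fun i => by linarith [hstep i]
    have hmem : ∀ i ≤ 2 ^ n, u i ∈ Icc t s := fun i hi => dyadic_mem_Icc hts hi
    have hl := M.law_cylinder t ht htT ξ (2 ^ n) u (fun _ => ξ t) (by simp [u])
      (fun i _ => hu i) ((hmem _ le_rfl).2.trans hs) rfl
    change _ ≤ M.law t ξ {ω | ∀ i : ℕ, i ≤ 2 ^ n → ω (u i) = ξ t}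
    rw [hl]
    refine ENNReal.ofReal_le_ofReal ?_
    have hb : ∀ i < 2 ^ n, 0 ≤ u i ∧ u (i + 1) ≤ T := fun i hi =>
      ⟨ht.trans (hmem i hi.le).1, (hmem (i + 1) hi).2.trans hs⟩
    have hprod := one_sub_mul_le_prod (q := fun i => M.Q (u i) (u (i + 1)) (ξ t) (ξ t))
      (a := C * ((s - t) / 2 ^ n)) (n := 2 ^ n)
      (fun i hi => M.nonneg _ _ (hb i hi).1 (hu i) (hb i hi).2 _ _)
      (fun i hi => M.Q_le_one (hb i hi).1 (hu i) (hb i hi).2 _ _)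
      (fun i hi => by rw [← hstep i]; exact hC _ _ (hb i hi).1 (hu i) (hb i hi).2 _)
    refine le_trans (le_of_eq ?_) hprod
    push_cast
    field_simp
  have hlim := tendsto_measure_iInter_atTop (μ := M.law t ξ) (s := dyadicStay T t s (ξ t))
    (fun n => (measurableSet_dyadicStay ht hts hs (ξ t) n).nullMeasurableSet)
    (dyadicStay_antitone t s (ξ t)) ⟨0, measure_ne_top _ _⟩
  rw [← stay_eq_iInter hts] at hlim
  have hge := ge_of_tendsto' hlim hn
  rw [prob_compl_eq_one_sub (measurableSet_stay ht hts hs _)]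
  refine tsub_le_iff_right.2 ?_
  calc (1 : ℝ≥0∞) = ENNReal.ofReal (C * (s - t) + (1 - C * (s - t))) := by simp
    _ ≤ ENNReal.ofReal (C * (s - t)) + ENNReal.ofReal (1 - C * (s - t)) := ENNReal.ofReal_add_le
    _ ≤ _ := by gcongr

end Holding

/-! ### Risk of random variables -/

section Risk

variable {X : Type*} {T : ℝ} {ϱ : ℝ → (Path X T → ℝ) → Path X T → ℝ}

theorem IsCoherent.map_zero (h : IsCoherent ϱ) {t : ℝ} (ht : t ∈ Icc 0 T) :
    ϱ t (fun _ => 0) = fun _ => 0 := by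
  have := h.pos_hom t ht (fun _ => 0) (RV_const T 0) 0 le_rfl
  rw [zero_smul, zero_smul] at this
  exact this

theorem IsCoherent.map_of_mem (h : IsCoherent ϱ) {t : ℝ} (ht : t ∈ Icc 0 T)
    {Y : Path X T → ℝ} (hY : Y ∈ RV X T t) : ϱ t Y = Y := by
  have h1 := h.translation t ht (fun _ => 0) (RV_const T 0) Y hY
  rw [h.map_zero ht] at h1
  have h2 : (Y + fun _ => (0 : ℝ)) = Y := add_zero Y
  rwa [h2] at h1

theorem IsCoherent.abs_map_le (h : IsCoherent ϱ) {t : ℝ} (ht : t ∈ Icc 0 T) {Z : Path X T → ℝ}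
    (hZ : Z ∈ RV X T T) {C : ℝ} (hC : ∀ ω, |Z ω| ≤ C) (ξ : Path X T) : |ϱ t Z ξ| ≤ C := by
  have h1 := h.mono t ht Z hZ (fun _ => C) (RV_const T C) (fun ω => (abs_le.1 (hC ω)).2) ξ
  have h2 := h.mono t ht (fun _ => -C) (RV_const T (-C)) Z hZ (fun ω => (abs_le.1 (hC ω)).1) ξ
  rw [h.map_of_mem ht (RV_const t _)] at h1 h2
  exact abs_le.2 ⟨h2, h1⟩

theorem risk_cost_eq_value {c : ℝ → X → ℝ} {B : ℝ} (hmarkov : IsMarkovian ϱ) (hc : ∀ x, Continuous fun τ => c τ x)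
    (hB : ∀ τ x, |c τ x| ≤ B) (f : X → ℝ) {t : ℝ} (ht : t ∈ Icc 0 T) (ξ : Path X T) :
    ϱ t (cost c f t) ξ = value ϱ c f t (ξ t) :=
  hmarkov t ht ξ (Path.const T (ξ t)) rfl c f fun x =>
    memLp_top_of_bound (hc x).aestronglyMeasurable B (.of_forall fun τ => hB τ x)

section Value

variable [Fintype X] {c : ℝ → X → ℝ} {B : ℝ}

theorem cost_mem_RV (hc : ∀ x, Continuous fun τ => c τ x) (hB : ∀ τ x, |c τ x| ≤ B)
    (f : X → ℝ) {t : ℝ} (ht : t ∈ Icc 0 T) : (cost c f t : Path X T → ℝ) ∈ RV X T T :=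
  RV_add (RV_integral hc hB (ht.1.trans ht.2) ht.2)
    (RV_coordinate (ht.1.trans ht.2) le_rfl f)

theorem cost_eq_add (hc : ∀ x, Continuous fun τ => c τ x) (hB : ∀ τ x, |c τ x| ≤ B)
    (f : X → ℝ) (t s : ℝ) : (cost c f t : Path X T → ℝ) =
      (fun ω => ∫ τ in t..s, c τ (ω τ)) + cost c f s := by
  ext ω
  have := intervalIntegral.integral_add_adjacent_intervals (ω.intervalIntegrable hc hB t s)
    (ω.intervalIntegrable hc hB s T)
  simp only [cost, Pi.add_apply]
  rw [← this, add_assoc]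

theorem exists_abs_value_le (hcoh : IsCoherent ϱ) (hc : ∀ x, Continuous fun τ => c τ x)
    (hB : ∀ τ x, |c τ x| ≤ B) (f : X → ℝ) :
    ∃ K : ℝ, 0 ≤ K ∧ ∀ t ∈ Icc 0 T, ∀ x, |value ϱ c f t x| ≤ K := by
  obtain ⟨C, hC0, hC⟩ := exists_abs_le f
  refine ⟨|B| * |T| + C, by positivity, fun t ht x => ?_⟩
  refine hcoh.abs_map_le ht (cost_mem_RV hc hB f ht) (fun ω => ?_) _
  refine (abs_add_le _ _).trans (add_le_add ?_ (hC _))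
  have h := intervalIntegral.norm_integral_le_of_norm_le_const (a := t) (b := T)
    (f := fun τ => c τ (ω τ)) (C := |B|) fun τ _ => (hB τ (ω τ)).trans (le_abs_self B)
  refine h.trans (mul_le_mul_of_nonneg_left ?_ (abs_nonneg B))
  rw [abs_of_nonneg (sub_nonneg.2 ht.2), abs_of_nonneg (ht.1.trans ht.2)]
  linarith [ht.1]

/-- The dynamic programming principle. -/
theorem value_eq_risk [DecidableEq X] {M : MarkovChain X T} (hcoh : IsCoherent ϱ)
    (hcons : IsStronglyConsistent M ϱ) (hmarkov : IsMarkovian ϱ)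
    (hc : ∀ x, Continuous fun τ => c τ x) (hB : ∀ τ x, |c τ x| ≤ B) (f : X → ℝ)
    {t s : ℝ} (ht : 0 ≤ t) (hts : t ≤ s) (hs : s ≤ T) (x : X) :
    value ϱ c f t x = ϱ t ((fun ω => ∫ τ in t..s, c τ (ω τ)) +
      fun ω => value ϱ c f s (ω s)) (Path.const T x) := by
  have htT : t ∈ Icc 0 T := ⟨ht, hts.trans hs⟩
  have hsT : s ∈ Icc 0 T := ⟨ht.trans hts, hs⟩
  have hA := RV_integral (T := T) hc hB hsT.1 hts
  have hW := RV_add hA (RV_coordinate hsT.1 le_rfl (value ϱ c f s))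
  have hZ := cost_mem_RV (T := T) hc hB f htT
  -- The two random variables have the same risk at time `s`, so consistency with `r₁ = r₂ = s`
  -- applies in both directions.
  have heq : ϱ s (cost c f t) = ϱ s ((fun ω => ∫ τ in t..s, c τ (ω τ)) +
      fun ω => value ϱ c f s (ω s)) := by
    rw [hcoh.map_of_mem hsT hW, cost_eq_add hc hB f t s,
      hcoh.translation s hsT _ (cost_mem_RV hc hB f hsT) _ hA]
    congr 1
    ext ω
    exact risk_cost_eq_value hmarkov hc hB f hsT ω
  have hW' := RV_mono hs hW
  have hsI : s ∈ Icc t T := ⟨hts, hs⟩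
  exact le_antisymm
    (hcons t htT s hsI s hsI _ _ hZ _ hW' fun η => by rw [heq])
    (hcons t htT s hsI s hsI _ _ hW' _ hZ fun η => by rw [heq])

end Value

/-- For random variables that are close unless the chain jumps, the Lipschitz property of the risk
measure gives a bound in terms of the length of the time interval. -/
theorem IsLpLipschitz.exists_modulus [Fintype X] [DecidableEq X] {M : MarkovChain X T}
    (hlip : IsLpLipschitz M ϱ) {G : ℝ → X → X → ℝ} (hG : IsRate T M.Q G) :
    ∃ L : ℝ, 0 ≤ L ∧ ∃ θ : ℝ → ℝ, (∀ h, 0 ≤ θ h) ∧ Tendsto θ (𝓝 0) (𝓝 0) ∧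
      ∀ t s, 0 ≤ t → t ≤ s → s ≤ T → ∀ ξ : Path X T, ∀ Z ∈ RV X T s, ∀ W ∈ RV X T s,
      ∀ a b : ℝ, 0 ≤ a → 0 ≤ b → (∀ ω, |Z ω - W ω| ≤ a + b) →
        (∀ ω ∈ stay T t s (ξ t), |Z ω - W ω| ≤ a) →
        |ϱ t Z ξ - ϱ t W ξ| ≤ L * (a + b * θ (s - t)) := by
  obtain ⟨p, hp1, hptop, L, hL⟩ := hlip
  obtain ⟨C, hC0, hC⟩ := M.exists_one_sub_Q_le hG
  have hp0 : p ≠ 0 := (zero_lt_one.trans_le hp1).ne'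
  have hq : 0 < 1 / p.toReal := one_div_pos.2 (ENNReal.toReal_pos hp0 hptop)
  -- The modulus is the `L_p` norm of the indicator of an event of probability at most `C * |h|`. It
  -- tends to `0` because `p` is finite; the absolute value keeps the base nonnegative for all real
  -- `h`.
  refine ⟨L, L.coe_nonneg, fun h => (C * |h|) ^ (1 / p.toReal), fun h => by positivity, ?_, ?_⟩
  · have hcont : Continuous fun h : ℝ => (C * |h|) ^ (1 / p.toReal) :=
      (continuous_const.mul continuous_abs).rpow_const fun _ => .inr hq.le
    have h0 := hcont.tendsto 0
    rwa [abs_zero, mul_zero, Real.zero_rpow hq.ne'] at h0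
  intro t s ht hts hs ξ Z hZ W hW a b ha hb hab hstay
  have htT := hts.trans hs
  have := M.law_prob t ht htT ξ
  have hh : 0 ≤ s - t := sub_nonneg.2 hts
  set E := (stay T t s (ξ t))ᶜ
  have hEm : MeasurableSet E := (measurableSet_stay ht hts hs (ξ t)).compl
  -- Domination by `a` plus `b` times the indicator of a jump; Minkowski then separates the two
  -- terms.
  have hbound : ∀ ω, ‖(Z - W) ω‖ ≤ ‖((fun _ => a : Path X T → ℝ) + E.indicator fun _ => b) ω‖ := by
    intro ω
    have hnn : 0 ≤ a + E.indicator (fun _ => b) ω :=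
      add_nonneg ha (indicator_nonneg (fun _ _ => hb) ω)
    rw [Pi.add_apply, Real.norm_of_nonneg hnn]
    by_cases hω : ω ∈ E
    · rw [indicator_of_mem hω]
      exact hab ω
    · rw [indicator_of_notMem hω, add_zero]
      exact hstay ω (not_not.1 hω)
  have hLp : eLpNorm (Z - W) p (M.law t ξ) ≤
      ENNReal.ofReal (a + b * (C * |s - t|) ^ (1 / p.toReal)) := by
    calc eLpNorm (Z - W) p (M.law t ξ)
        ≤ eLpNorm ((fun _ => a : Path X T → ℝ) + E.indicator fun _ => b) p (M.law t ξ) := eLpNorm_mono hbound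
      _ ≤ eLpNorm (fun _ : Path X T => a) p (M.law t ξ) + eLpNorm (E.indicator fun _ => b) p (M.law t ξ) :=
        eLpNorm_add_le aestronglyMeasurable_const
          (aestronglyMeasurable_const.indicator hEm) hp1
      _ = ENNReal.ofReal a + ENNReal.ofReal b * M.law t ξ E ^ (1 / p.toReal) := by
        rw [eLpNorm_const a hp0 (IsProbabilityMeasure.ne_zero _),
          eLpNorm_indicator_const hEm hp0 hptop, measure_univ, ENNReal.one_rpow, mul_one,
          Real.enorm_of_nonneg ha, Real.enorm_of_nonneg hb]
      _ ≤ ENNReal.ofReal a +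
          ENNReal.ofReal b * ENNReal.ofReal (C * |s - t|) ^ (1 / p.toReal) := by
        have := M.law_compl_stay_le hC ht hts hs ξ
        rw [abs_of_nonneg hh]
        gcongr
      _ = _ := by
        rw [ENNReal.ofReal_rpow_of_nonneg (by positivity) hq.le, ← ENNReal.ofReal_mul hb,
          ← ENNReal.ofReal_add ha (by positivity)]
  have h1 := (hL t ⟨ht, htT⟩ s ⟨hts, hs⟩ ξ Z hZ W hW).trans (mul_le_mul_right hLp (L : ℝ≥0∞))
  rw [← ENNReal.ofReal_coe_nnreal, ← ENNReal.ofReal_mul L.coe_nonneg] at h1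
  exact (ENNReal.ofReal_le_ofReal_iff (by positivity)).1 h1

end Risk

/-! ### One step of the approximation -/

theorem exists_uniform_modulus {X : Type*} [Finite X] {c : ℝ → X → ℝ}
    (hc : ∀ x, UniformContinuous fun τ => c τ x) {e : ℝ}
    (he : 0 < e) : ∃ δ > 0, ∀ t s, |t - s| < δ → ∀ x, |c t x - c s x| ≤ e := by
  have h : ∀ x, ∀ᶠ δ : ℝ in 𝓝[>] 0, ∀ t s, |t - s| < δ → |c t x - c s x| ≤ e := by
    intro x
    obtain ⟨δ, hδ, h⟩ := Metric.uniformContinuous_iff.1 (hc x) e he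
    filter_upwards [Ioo_mem_nhdsGT hδ] with d hd t s hts
    exact (h (a := t) (b := s) (hts.trans hd.2)).le
  obtain ⟨δ, hδ, hpos⟩ := ((Filter.eventually_all.2 h).and self_mem_nhdsWithin).exists
  exact ⟨δ, hpos, fun t s hts x => hδ x t s hts⟩

section OneStep

variable {X : Type*} [Fintype X] [DecidableEq X] {T : ℝ} {M : MarkovChain X T}
  {G : ℝ → X → X → ℝ} {ϱ : ℝ → (Path X T → ℝ) → Path X T → ℝ} {c : ℝ → X → ℝ} {B : ℝ}

/-- By dynamic programming both values are risks at time `t`, one of them of the constant `value ϱ c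
f s x`. Without a jump only the running cost, of order `s - t`, separates the two random variables;
with a jump, at most `2 * K` more. -/
theorem exists_abs_value_sub_le (hG : IsRate T M.Q G) (hcoh : IsCoherent ϱ)
    (hcons : IsStronglyConsistent M ϱ) (hmarkov : IsMarkovian ϱ) (hlip : IsLpLipschitz M ϱ)
    (hc : ∀ x, Continuous fun τ => c τ x) (hB : ∀ τ x, |c τ x| ≤ B) (f : X → ℝ)
    {e : ℝ} (he : 0 < e) : ∃ δ > 0, ∀ t s, 0 ≤ t → t ≤ s → s ≤ T → s - t < δ → ∀ x,
      |value ϱ c f t x - value ϱ c f s x| ≤ e := by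
  obtain ⟨L, hL0, θ, hθ0, hθ, hL⟩ := hlip.exists_modulus hG
  obtain ⟨K, hK0, hK⟩ := exists_abs_value_le (T := T) hcoh hc hB f
  have hlim : Tendsto (fun h : ℝ => L * (|B| * |h| + 2 * K * θ h)) (𝓝 0) (𝓝 0) := by
    have h1 : Tendsto (fun h : ℝ => |h|) (𝓝 0) (𝓝 0) := by
      simpa using continuous_abs.tendsto (0 : ℝ)
    simpa using ((h1.const_mul |B|).add (hθ.const_mul (2 * K))).const_mul L
  obtain ⟨δ, hδ, hball⟩ := Metric.eventually_nhds_iff.1 (hlim.eventually_le_const he)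
  refine ⟨δ, hδ, fun t s ht hts hs hst x => ?_⟩
  have hsT : s ∈ Icc 0 T := ⟨ht.trans hts, hs⟩
  have htT : t ∈ Icc 0 T := ⟨ht, hts.trans hs⟩
  have hh : 0 ≤ s - t := sub_nonneg.2 hts
  have hA := RV_integral (T := T) hc hB hsT.1 hts
  have hW := RV_add hA (RV_coordinate hsT.1 le_rfl (value ϱ c f s))
  have hint : ∀ ω : Path X T, |∫ τ in t..s, c τ (ω τ)| ≤ |B| * |s - t| := fun ω =>
    intervalIntegral.norm_integral_le_of_norm_le_const (f := fun τ => c τ (ω τ))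
      fun τ _ => (hB τ (ω τ)).trans (le_abs_self B)
  have h := hL t s ht hts hs (Path.const T x) _ hW _ (RV_const s (value ϱ c f s x))
    (|B| * |s - t|) (2 * K) (by positivity) (by positivity) ?_ ?_
  · rw [← value_eq_risk hcoh hcons hmarkov hc hB f ht hts hs x,
      hcoh.map_of_mem htT (RV_const t _)] at h
    exact h.trans (hball (by rwa [Real.dist_eq, sub_zero, abs_of_nonneg hh]))
  · intro ω
    have h1 := abs_le.1 (hint ω)
    have h2 := abs_le.1 (hK s hsT (ω s))
    have h3 := abs_le.1 (hK s hsT x)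
    simp only [Pi.add_apply]
    exact abs_le.2 ⟨by linarith, by linarith⟩
  · intro ω hω
    have h1 : ω s = x := hω s ⟨hts, le_rfl⟩
    simp only [Pi.add_apply, h1, add_sub_cancel_right]
    exact hint ω

/-- Local consistency of the scheme: the terms in the value at `X_s` cancel, so even on the jump
event the discrepancy is `O(s - t)`. The small jump probability then improves this to `o(s - t)`. -/
theorem exists_abs_value_sub_step_le (hG : IsRate T M.Q G) (hcoh : IsCoherent ϱ)
    (hcons : IsStronglyConsistent M ϱ) (hmarkov : IsMarkovian ϱ) (hlip : IsLpLipschitz M ϱ)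
    {σ : ℝ → X → (X → ℝ) → (X → ℝ) → ℝ} (hσ : IsTransitionRiskMapping M ϱ σ)
    (hc : ∀ x, UniformContinuous fun τ => c τ x) (hB : ∀ τ x, |c τ x| ≤ B) (f : X → ℝ)
    {e : ℝ} (he : 0 < e) : ∃ δ > 0, ∀ t s, 0 ≤ t → t ≤ s → s ≤ T → s - t < δ → ∀ x,
      |value ϱ c f t x - ((s - t) * c t x + σ t x (M.Q t s x) (value ϱ c f s))| ≤
        e * (s - t) := by
  have hcc : ∀ x, Continuous fun τ => c τ x := fun x => (hc x).continuous
  obtain ⟨L, hL0, θ, hθ0, hθ, hL⟩ := hlip.exists_modulus hG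
  -- Half of the budget goes to the oscillation of `c`, half to jumps; `L + 1` avoids dividing by a
  -- zero Lipschitz constant.
  have hη : 0 < e / (2 * (L + 1)) := by positivity
  obtain ⟨δ₁, hδ₁, hmod⟩ := exists_uniform_modulus hc hη
  have hlim : Tendsto (fun h : ℝ => 2 * |B| * θ h) (𝓝 0) (𝓝 0) := by
    simpa using hθ.const_mul (2 * |B|)
  obtain ⟨δ₂, hδ₂, hball⟩ := Metric.eventually_nhds_iff.1 (hlim.eventually_le_const hη)
  refine ⟨min δ₁ δ₂, lt_min hδ₁ hδ₂, fun t s ht hts hs hst x => ?_⟩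
  obtain ⟨hst₁, hst₂⟩ := lt_min_iff.1 hst
  have hsT : s ∈ Icc 0 T := ⟨ht.trans hts, hs⟩
  have htT : t ∈ Icc 0 T := ⟨ht, hts.trans hs⟩
  have hh : 0 ≤ s - t := sub_nonneg.2 hts
  have hA := RV_integral (T := T) hcc hB hsT.1 hts
  have hV := RV_coordinate (T := T) hsT.1 le_rfl (value ϱ c f s)
  have hW := RV_add hA hV
  have hW' := RV_add (RV_const (X := X) (T := T) s ((s - t) * c t x)) hV
  have hdiff : ∀ ω : Path X T, (∫ τ in t..s, c τ (ω τ)) - (s - t) * c t x =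
      ∫ τ in t..s, (c τ (ω τ) - c t x) := by
    intro ω
    rw [intervalIntegral.integral_sub (ω.intervalIntegrable hcc hB t s)
      intervalIntegrable_const]
    simp
  have h := hL t s ht hts hs (Path.const T x) _ hW _ hW'
    (e / (2 * (L + 1)) * (s - t)) (2 * |B| * (s - t)) (by positivity) (by positivity) ?_ ?_
  · have hrep := hσ.represents t htT s ⟨hts, hs⟩ (Path.const T x) (value ϱ c f s)
    rw [← value_eq_risk hcoh hcons hmarkov hcc hB f ht hts hs x,
      hcoh.translation t htT _ (RV_mono hs hV) _ (RV_const t _), Pi.add_apply, ← hrep] at h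
    refine h.trans ?_
    have hθ' : 2 * |B| * θ (s - t) ≤ e / (2 * (L + 1)) :=
      hball (by rwa [Real.dist_eq, sub_zero, abs_of_nonneg hh])
    calc L * (e / (2 * (L + 1)) * (s - t) + 2 * |B| * (s - t) * θ (s - t))
        ≤ (L + 1) * ((e / (2 * (L + 1)) + e / (2 * (L + 1))) * (s - t)) := by
          have h2 := mul_le_mul_of_nonneg_right hθ' hh
          have : 0 ≤ θ (s - t) := hθ0 _
          refine mul_le_mul (by linarith) (by linarith) (by positivity) (by positivity)
      _ = e * (s - t) := by field_simp; ring
  · intro ω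
    simp only [Pi.add_apply, add_sub_add_right_eq_sub]
    rw [hdiff]
    have := intervalIntegral.norm_integral_le_of_norm_le_const (a := t) (b := s)
      (f := fun τ => c τ (ω τ) - c t x) (C := 2 * |B|) fun τ _ => by
        refine (abs_sub _ _).trans ?_
        linarith [hB τ (ω τ), hB t x, le_abs_self B]
    rw [abs_of_nonneg hh] at this
    refine this.trans (le_add_of_nonneg_left (by positivity))
  · intro ω hω
    simp only [Pi.add_apply, add_sub_add_right_eq_sub]
    rw [hdiff]
    have := intervalIntegral.norm_integral_le_of_norm_le_const (a := t) (b := s)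
      (f := fun τ => c τ (ω τ) - c t x) (C := e / (2 * (L + 1))) fun τ hτ => by
        rw [uIoc_of_le hts] at hτ
        have h1 : ω τ = x := hω τ ⟨hτ.1.le, hτ.2⟩
        rw [h1]
        refine hmod τ t ?_ x
        rw [abs_of_pos (sub_pos.2 hτ.1)]
        linarith [hτ.2]
    rwa [abs_of_nonneg hh] at this

end OneStep

/-! ### The discrete-time recursion -/

section Recursion

variable {X : Type*} {T : ℝ}

/-- Monotonicity and translation invariance alone make a risk measure nonexpansive in the sup norm.
-/
theorem IsCoherentFn.abs_sub_le {s : (X → ℝ) → ℝ} (h : IsCoherentFn s) {v w : X → ℝ} {d : ℝ}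
    (hd : ∀ x, |v x - w x| ≤ d) : |s v - s w| ≤ d := by
  have h1 := h.mono v (fun x => d + w x) fun x => by linarith [(abs_le.1 (hd x)).2]
  have h2 := h.mono w (fun x => d + v x) fun x => by linarith [(abs_le.1 (hd x)).1]
  rw [h.translation] at h1 h2
  exact abs_le.2 ⟨by linarith, by linarith⟩

theorem grid_succ_sub (T : ℝ) (N i : ℕ) : grid T N (i + 1) - grid T N i = T / N := by
  simp only [grid]
  push_cast
  ring

theorem grid_last (T : ℝ) {N : ℕ} (hN : 0 < N) : grid T N N = T := by
  have : (N : ℝ) ≠ 0 := by positivity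
  simp only [grid]
  field_simp

theorem grid_mono (hT : 0 ≤ T) (N : ℕ) : Monotone (grid T N) := by
  intro i j hij
  simp only [grid]
  gcongr

theorem grid_nonneg (hT : 0 ≤ T) (N i : ℕ) : 0 ≤ grid T N i := by
  simp only [grid]
  positivity

/-- Stability: each backward step carries the previous error over without amplification and adds one
local error. -/
theorem abs_discreteValue_sub_le {Q : ℝ → ℝ → X → X → ℝ}
    {σ : ℝ → X → (X → ℝ) → (X → ℝ) → ℝ} {c : ℝ → X → ℝ} {f : X → ℝ} {V : ℝ → X → ℝ} {N : ℕ}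
    {d : ℝ} (hσ : ∀ i < N, ∀ x, IsCoherentFn (σ (grid T N i) x (Q (grid T N i) (grid T N (i + 1)) x)))
    (hV : ∀ x, V (grid T N N) x = f x)
    (hstep : ∀ i < N, ∀ x, |V (grid T N i) x - ((T / N) * c (grid T N i) x +
      σ (grid T N i) x (Q (grid T N i) (grid T N (i + 1)) x) (V (grid T N (i + 1))))| ≤ d)
    (k : ℕ) : ∀ i, i + k = N → ∀ x, |discreteValue T Q σ c f N i x - V (grid T N i) x| ≤ k * d := by
  induction k with
  | zero =>
    rintro i rfl x
    simp only [add_zero] at hV ⊢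
    rw [discreteValue_last, hV]
    simp
  | succ k ih =>
    intro i hi x
    have hiN : i < N := by lia
    have h1 := abs_le.1 ((hσ i hiN x).abs_sub_le (ih (i + 1) (by lia)))
    have h2 := abs_le.1 (hstep i hiN x)
    rw [discreteValue_step T Q σ c f N i hiN x]
    push_cast
    exact abs_le.2 ⟨by linarith, by linarith⟩

theorem interpolate_of_mem_Icc (hT : 0 < T) {N : ℕ} (hN : 0 < N) (V : ℕ → X → ℝ) {i : ℕ} {t : ℝ}
    (ht : t ∈ Icc (grid T N i) (grid T N (i + 1))) (x : X) :
    interpolate T N V t x = (grid T N (i + 1) - t) / (T / N) * V i x +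
      (t - grid T N i) / (T / N) * V (i + 1) x := by
  have hh : 0 < T / N := by positivity
  rcases ht.2.eq_or_lt with rfl | hlt
  -- At the right endpoint the floor already selects the next cell, where `V (i + 1)` has weight
  -- one. For `t = T` the value `V (N + 1)` therefore enters with weight zero.
  · have hfloor : ⌊grid T N (i + 1) / (T / N)⌋₊ = i + 1 := by
      simp only [grid, mul_div_cancel_right₀ _ hh.ne', Nat.floor_natCast]
    simp only [interpolate, hfloor, grid_succ_sub, sub_self, zero_div, zero_mul, add_zero,
      zero_add, div_self hh.ne']
  · have hfloor : ⌊t / (T / N)⌋₊ = i := by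
      have h0 : 0 ≤ t := (grid_nonneg hT.le N i).trans ht.1
      rw [Nat.floor_eq_iff (by positivity), le_div_iff₀ hh, div_lt_iff₀ hh]
      refine ⟨ht.1, ?_⟩
      simpa [grid] using hlt
    simp only [interpolate, hfloor, grid_succ_sub]

theorem exists_mem_Icc_grid {N : ℕ} (hN : 0 < N) {t : ℝ} (ht : t ∈ Icc 0 T) :
    ∃ i < N, t ∈ Icc (grid T N i) (grid T N (i + 1)) := by
  have key : ∀ n : ℕ, 0 < n → t ≤ grid T N n → ∃ i < n, t ∈ Icc (grid T N i) (grid T N (i + 1)) := by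
    intro n
    induction n with
    | zero => intro h; exact absurd h (lt_irrefl 0)
    | succ n ih =>
      intro _ htn
      rcases le_or_gt (grid T N n) t with h | h
      · exact ⟨n, n.lt_succ_self, h, htn⟩
      · rcases n.eq_zero_or_pos with rfl | hn
        · simp only [grid, Nat.cast_zero, zero_mul] at h
          exact absurd h (not_lt.2 ht.1)
        · obtain ⟨i, hi, hi'⟩ := ih hn h.le
          exact ⟨i, hi.trans n.lt_succ_self, hi'⟩
  exact key N hN (by rw [grid_last T hN]; exact ht.2)

theorem continuousOn_interpolate (hT : 0 < T) {N : ℕ} (hN : 0 < N) (V : ℕ → X → ℝ) (x : X) :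
    ContinuousOn (fun t => interpolate T N V t x) (Icc 0 T) := by
  have hpiece : ∀ i, ContinuousOn (fun t => interpolate T N V t x)
      (Icc (grid T N i) (grid T N (i + 1))) := by
    intro i
    refine ContinuousOn.congr (f := fun t => (grid T N (i + 1) - t) / (T / N) * V i x +
      (t - grid T N i) / (T / N) * V (i + 1) x) ?_ fun t ht => interpolate_of_mem_Icc hT hN V ht x
    fun_prop
  have hall : ∀ n, ContinuousOn (fun t => interpolate T N V t x) (Icc (grid T N 0) (grid T N n)) := by
    intro n
    induction n with
    | zero => simp
    | succ n ih =>
      rw [← Icc_union_Icc_eq_Icc (grid_mono hT.le N n.zero_le) (grid_mono hT.le N n.le_succ)]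
      exact ih.union_of_isClosed (hpiece n) isClosed_Icc isClosed_Icc
  have h := hall N
  rw [grid_last T hN] at h
  simpa [grid] using h

theorem abs_interpolate_sub_le (hT : 0 < T) {N : ℕ} (hN : 0 < N) {V : ℕ → X → ℝ} {i : ℕ} {t : ℝ}
    (ht : t ∈ Icc (grid T N i) (grid T N (i + 1))) {x : X} {a d : ℝ} (h0 : |V i x - a| ≤ d)
    (h1 : |V (i + 1) x - a| ≤ d) : |interpolate T N V t x - a| ≤ d := by
  have hh : 0 < T / N := by positivity
  rw [interpolate_of_mem_Icc hT hN V ht]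
  have hl : 0 ≤ (grid T N (i + 1) - t) / (T / N) := div_nonneg (sub_nonneg.2 ht.2) hh.le
  have hm : 0 ≤ (t - grid T N i) / (T / N) := div_nonneg (sub_nonneg.2 ht.1) hh.le
  have hsum : (grid T N (i + 1) - t) / (T / N) + (t - grid T N i) / (T / N) = 1 := by
    rw [← add_div, sub_add_sub_cancel, grid_succ_sub, div_self hh.ne']
  rw [← Real.dist_eq, ← Metric.mem_closedBall] at h0 h1 ⊢
  exact convex_closedBall a d h0 h1 hl hm hsum

end Recursion

/-! ### Extension of the cost rates -/

/-- Freezing `c` at the endpoints of `[0,T]` gives the global continuity and boundedness that the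
measurability and integrability arguments use. -/
theorem exists_uniformContinuous_extension {X : Type*} [Fintype X] {T : ℝ} (hT : 0 ≤ T)
    {c : ℝ → X → ℝ} (hc : ∀ x, UniformContinuousOn (fun t => c t x) (Icc 0 T)) :
    ∃ c' : ℝ → X → ℝ, (∀ t ∈ Icc 0 T, ∀ x, c' t x = c t x) ∧
      (∀ x, UniformContinuous fun t => c' t x) ∧ ∃ B : ℝ, ∀ t x, |c' t x| ≤ B := by
  refine ⟨fun t x => c (projIcc 0 T hT t) x, fun t ht x => by simp [projIcc_of_mem hT ht],
    fun x => ?_, ?_⟩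
  · exact (uniformContinuousOn_iff_restrict.1 (hc x)).comp
      (LipschitzWith.projIcc hT).uniformContinuous
  · choose B hB using fun x => isCompact_Icc.exists_bound_of_continuousOn (hc x).continuousOn
    obtain ⟨K, -, hK⟩ := exists_abs_le B
    exact ⟨K, fun t x => (hB x _ (projIcc 0 T hT t).2).trans ((le_abs_self _).trans (hK x))⟩

theorem value_congr {X : Type*} {T : ℝ} {ϱ : ℝ → (Path X T → ℝ) → Path X T → ℝ}
    {c c' : ℝ → X → ℝ} (h : ∀ t ∈ Icc 0 T, ∀ x, c' t x = c t x) (f : X → ℝ) {t : ℝ}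
    (ht : t ∈ Icc 0 T) : value ϱ c' f t = value ϱ c f t := by
  have : (cost c' f t : Path X T → ℝ) = cost c f t := by
    ext ω
    simp only [cost]
    congr 1
    refine intervalIntegral.integral_congr fun τ hτ => ?_
    rw [uIcc_of_le ht.2] at hτ
    exact h τ ⟨ht.1.trans hτ.1, hτ.2⟩ _
  ext x
  rw [value, value, this]

theorem value_horizon {X : Type*} [Fintype X] {T : ℝ}
    {ϱ : ℝ → (Path X T → ℝ) → Path X T → ℝ} (hcoh : IsCoherent ϱ) (hT : 0 ≤ T)
    (c : ℝ → X → ℝ) (f : X → ℝ) (x : X) : value ϱ c f T x = f x := by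
  have : (cost c f T : Path X T → ℝ) = fun ω => f (ω T) := by
    ext ω
    simp [cost]
  rw [value, this, hcoh.map_of_mem ⟨hT, le_rfl⟩ (RV_coordinate hT le_rfl f)]
  rfl

end RiskChain

theorem theorem9p2 {X : Type*} [Fintype X] [DecidableEq X] (T : ℝ) (hT : 0 < T)
    -- the chain and its transition rates
    (M : RiskChain.MarkovChain X T) (G : ℝ → X → X → ℝ) (hG : RiskChain.IsRate T M.Q G)
    -- the dynamic risk measure
    (ϱ : ℝ → (RiskChain.Path X T → ℝ) → RiskChain.Path X T → ℝ)
    (hϱ : RiskChain.IsDynamicRiskMeasure ϱ)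
    (hcoh : RiskChain.IsCoherent ϱ)
    (hcons : RiskChain.IsStronglyConsistent M ϱ)
    (hmarkov : RiskChain.IsMarkovian ϱ)
    (hlip : RiskChain.IsLpLipschitz M ϱ)
    -- its transition risk mappings and their multigenerators
    (σ : ℝ → X → (X → ℝ) → (X → ℝ) → ℝ)
    (hσ : RiskChain.IsTransitionRiskMapping M ϱ σ)
    (Γ : ℝ → X → Set (RiskChain.SMeas X))
    (hΓ : RiskChain.IsMultigenerator T σ G Γ)
    (hΓ_meas : ∀ x, RiskChain.IsMeasurableMulti T (fun t => Γ t x))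
    (hΓ_bdd : ∃ B : ℝ, ∀ t ∈ Set.Ico 0 T, ∀ x, ∀ μ ∈ Γ t x, ‖μ‖ ≤ B)
    (hΓ_cont : ∀ x, RiskChain.IsUnifContMulti T (fun t => Γ t x))
    -- the costs
    (c : ℝ → X → ℝ) (hc : ∀ x, UniformContinuousOn (fun t => c t x) (Set.Icc 0 T))
    (f : X → ℝ) :
    (∀ N : ℕ, 0 < N → ∀ x,
      ContinuousOn (fun t => RiskChain.approxValue T M.Q σ c f N t x) (Set.Icc 0 T)) ∧
    (∀ x, ContinuousOn (fun t => RiskChain.value ϱ c f t x) (Set.Icc 0 T)) ∧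
    TendstoUniformlyOn
      (fun (N : ℕ) (p : ℝ × X) => RiskChain.approxValue T M.Q σ c f N p.1 p.2)
      (fun p => RiskChain.value ϱ c f p.1 p.2) Filter.atTop
      (Set.Icc 0 T ×ˢ Set.univ) := by
  obtain ⟨c', hcc', hc', B, hB⟩ := RiskChain.exists_uniformContinuous_extension hT.le hc
  have hcont := fun e (he : 0 < e) => RiskChain.exists_abs_value_sub_le hG hcoh hcons hmarkov hlip
    (fun x => (hc' x).continuous) hB f he
  have hval : ∀ t ∈ Set.Icc 0 T, RiskChain.value ϱ c' f t = RiskChain.value ϱ c f t :=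
    fun t ht => RiskChain.value_congr hcc' f ht
  refine ⟨fun N hN x => RiskChain.continuousOn_interpolate hT hN _ x, fun x => ?_, ?_⟩
  · rw [Metric.continuousOn_iff]
    intro t ht e he
    obtain ⟨δ, hδ, h⟩ := hcont (e / 2) (half_pos he)
    refine ⟨δ, hδ, fun s hs hst => ?_⟩
    rw [Real.dist_eq] at hst ⊢
    rw [← hval t ht, ← hval s hs]
    rcases le_total s t with hle | hle
    · have := h s t hs.1 hle ht.2 (by linarith [neg_abs_le (s - t)]) x
      linarith
    · have := h t s ht.1 hle hs.2 (by linarith [le_abs_self (s - t)]) x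
      rw [abs_sub_comm]
      linarith
  · rw [Metric.tendstoUniformlyOn_iff]
    intro e he
    obtain ⟨δ₁, hδ₁, h₁⟩ := hcont (e / 4) (by positivity)
    -- With relative error `e / (4 * T)`, at most `N` steps of length `T / N` accumulate no more
    -- than `e / 4`.
    obtain ⟨δ₂, hδ₂, h₂⟩ := RiskChain.exists_abs_value_sub_step_le hG hcoh hcons hmarkov hlip hσ
      hc' hB f (e := e / (4 * T)) (by positivity)
    have hmesh : Filter.Tendsto (fun N : ℕ => T / N) Filter.atTop (nhds 0) :=
      tendsto_const_div_atTop_nhds_zero_nat T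
    filter_upwards [hmesh.eventually_lt_const (lt_min hδ₁ hδ₂), Filter.eventually_gt_atTop 0]
      with N hNδ hN p hp
    obtain ⟨hN₁, hN₂⟩ := lt_min_iff.1 hNδ
    obtain ⟨t, x⟩ := p
    have ht : t ∈ Set.Icc 0 T := hp.1
    have hNpos : (0 : ℝ) < N := by positivity
    have hgT : ∀ i ≤ N, RiskChain.grid T N i ∈ Set.Icc 0 T := fun i hi =>
      ⟨RiskChain.grid_nonneg hT.le N i,
        (RiskChain.grid_mono hT.le N hi).trans_eq (RiskChain.grid_last T hN)⟩
    have hgrid : ∀ i ≤ N, |RiskChain.discreteValue T M.Q σ c f N i x -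
        RiskChain.value ϱ c' f (RiskChain.grid T N i) x| ≤ e / 4 := by
      intro i hi
      have h := RiskChain.abs_discreteValue_sub_le (Q := M.Q) (σ := σ) (c := c) (f := f)
        (V := RiskChain.value ϱ c' f) (N := N) (d := e / (4 * T) * (T / N)) (T := T)
        (fun i hi x => hσ.coherent _ (hgT i hi.le) x _
          ⟨M.nonneg _ _ (hgT i hi.le).1 (RiskChain.grid_mono hT.le N i.le_succ) (hgT _ hi).2 x,
            M.sum_eq_one _ _ (hgT i hi.le).1 (RiskChain.grid_mono hT.le N i.le_succ)
              (hgT _ hi).2 x⟩)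
        (fun x => by
          rw [RiskChain.grid_last T hN]
          exact RiskChain.value_horizon hcoh hT.le c' f x)
        (fun i hi x => by
          have := h₂ _ _ (hgT i hi.le).1 (RiskChain.grid_mono hT.le N i.le_succ) (hgT _ hi).2
            (by rwa [RiskChain.grid_succ_sub]) x
          -- The recursion uses `c`, the local estimate its extension; they agree at grid points.
          rwa [RiskChain.grid_succ_sub, hcc' _ (hgT i hi.le)] at this)
        (N - i) i (by lia) x
      refine h.trans ?_
      have hle : ((N - i : ℕ) : ℝ) ≤ N := by exact_mod_cast Nat.sub_le N i
      calc ((N - i : ℕ) : ℝ) * (e / (4 * T) * (T / N)) ≤ N * (e / (4 * T) * (T / N)) := by gcongr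
        _ = e / 4 := by field_simp
    obtain ⟨i, hi, hti⟩ := RiskChain.exists_mem_Icc_grid hN ht
    have hlen := RiskChain.grid_succ_sub T N i
    have ha := h₁ _ _ (hgT i hi.le).1 hti.1 ht.2 (by linarith [hti.2]) x
    have hb := h₁ _ _ ht.1 hti.2 (hgT (i + 1) hi).2 (by linarith [hti.1]) x
    -- Both neighbouring grid values are within `e / 4 + e / 4` of the value at `t`: scheme error
    -- plus time increment. Their convex combination is then equally close.
    have hclose : |RiskChain.approxValue T M.Q σ c f N t x - RiskChain.value ϱ c' f t x| ≤
        e / 2 := by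
      refine RiskChain.abs_interpolate_sub_le hT hN hti ?_ ?_
      · have := abs_sub_le (RiskChain.discreteValue T M.Q σ c f N i x)
          (RiskChain.value ϱ c' f (RiskChain.grid T N i) x) (RiskChain.value ϱ c' f t x)
        linarith [hgrid i hi.le]
      · have := abs_sub_le (RiskChain.discreteValue T M.Q σ c f N (i + 1) x)
          (RiskChain.value ϱ c' f (RiskChain.grid T N (i + 1)) x) (RiskChain.value ϱ c' f t x)
        rw [abs_sub_comm (RiskChain.value ϱ c' f (RiskChain.grid T N (i + 1)) x)] at this
        linarith [hgrid (i + 1) hi]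
    rw [hval t ht] at hclose
    rw [dist_comm, Real.dist_eq]
    linarith
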